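/- Let $\mathcal A$ be a set (an alphabet, not necessarily finite), $R$ an associative, not necessarily commutative ring with unit, and $k\ge 2$ an integer. Let $X$ and $Y_\alpha$ ($\alpha\in\mathcal A$) be noncommuting variables, which do not commute with the elements of $R$ either. Let $S$ be the ring of formal power series in these variables with coefficients in $R$: its elements are the (generally infinite) formal sums of monomials $\pm r_1Z_1r_2Z_2\cdots Z_lr_{l+1}$ with $r_i\in R$ and $Z_i\in\{X\}\cup\{Y_\alpha\}$. More precisely, $S=\prod_w R^{\otimes_{\mathbf Z}(|w|+1)}$, the product being over all finite words $w$ in the variables, of length $|w|$, i.e. $S$ is the word-wise completion of the free product of the rings $R$ and $\mathbf Z\langle X,Y_\alpha\rangle$. Infinite sums are formed separately for each word $w$, and are allowed when each word occurs in only finitely many of the summands. For $f,h\in S$ such that every monomial of $h$ has degree at least $1$ in $X$, the composition $f\circ_X h$ is obtained by replacing every occurrence of $X$ in every monomial of $f$ by $h$. Let $M_1,\dots,M_k$ be matrices with rows and columns indexed by $\mathcal A$ and coefficients $M_j(\alpha,\beta)\in R$, and let $\tilde M_j=J-M_j$, where $J$ is the matrix all of whose coefficients are $1$. Then there is a unique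 family $(g_\alpha)_{\alpha\in\mathcal A}$ in $S$ with $g_\alpha=Y_\alpha X^k+(\text{terms of degree}>k\text{ in }X)$ and $$g_\alpha=Y_\alpha\Bigl(X-\sum_\beta M_1(\alpha,\beta)g_\beta\Bigr)\cdots\Bigl(X-\sum_\beta M_k(\alpha,\beta)g_\beta\Bigr)\qquad(\alpha\in\mathcal A),$$ and a unique family $(\tilde g_\alpha)_{\alpha\in\mathcal A}$ in $S$ with $\tilde g_\alpha=Y_\alpha(-X)^k+(\text{terms of degree}>k\text{ in }X)$ and $$\tilde g_\alpha=Y_\alpha\Bigl(-X+\sum_\beta \tilde M_1(\alpha,\beta)\tilde g_\beta\Bigr)\cdots\Bigl(-X+\sum_\beta \tilde M_k(\alpha,\beta)\tilde g_\beta\Bigr)\qquad(\alpha\in\mathcal A).$$ The sums $g=-X+\sum_{\alpha\in\mathcal A} g_\alpha$ and $\tilde g=-X+\sum_{\alpha\in\mathcal A}\tilde g_\alpha$ and both compositions of $g$ and $\tilde g$ are well defined, and $$g\circ_X\tilde g=\tilde g\circ_X g=X.$$ -/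

import Mathlib

/-- The letters: the variable `X` and one variable `Y α` for every `α` of the alphabet `A`. -/
inductive Letter (A : Type*) where
  | X : Letter A
  | Y (a : A) : Letter A

/-- The degree in `X` of a word, i.e. the number of occurrences of the letter `X`. -/
def xdeg {A : Type*} : List (Letter A) → ℕ
  | [] => 0
  | Letter.X :: w => xdeg w + 1
  | Letter.Y _ :: w => xdeg w

section Polynomials

variable (R : Type*) [Ring R] (A : Type*)

/-- The relations that turn the formal symbols `inl r`, `r ∈ R`, into a ring homomorphism on `R`.
No relation is imposed on the letters `inr z`. -/
inductive PolyRel : FreeAlgebra ℤ (R ⊕ Letter A) → FreeAlgebra ℤ (R ⊕ Letter A) → Prop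
  | one : PolyRel (FreeAlgebra.ι ℤ (Sum.inl 1)) 1
  | add (r s : R) : PolyRel (FreeAlgebra.ι ℤ (Sum.inl (r + s)))
      (FreeAlgebra.ι ℤ (Sum.inl r) + FreeAlgebra.ι ℤ (Sum.inl s))
  | mul (r s : R) : PolyRel (FreeAlgebra.ι ℤ (Sum.inl (r * s)))
      (FreeAlgebra.ι ℤ (Sum.inl r) * FreeAlgebra.ι ℤ (Sum.inl s))

/-- The ring of noncommutative polynomials in the letters, whose coefficients in `R` do not commute
with the letters: the free product (coproduct of rings) of `R` and `ℤ⟨X, Y_α⟩`. Its elements are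
finite sums of monomials `± r₁ Z₁ r₂ Z₂ ⋯ Z_l r_{l+1}`. -/
def NCPoly := RingQuot (PolyRel R A)

noncomputable instance : Ring (NCPoly R A) := inferInstanceAs (Ring (RingQuot (PolyRel R A)))

/-- The quotient map. -/
noncomputable def NCPoly.mk : FreeAlgebra ℤ (R ⊕ Letter A) →+* NCPoly R A :=
  RingQuot.mkRingHom (PolyRel R A)

theorem NCPoly.mk_rel {x y : FreeAlgebra ℤ (R ⊕ Letter A)} (h : PolyRel R A x y) :
    NCPoly.mk R A x = NCPoly.mk R A y :=
  RingQuot.mkRingHom_rel h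

/-- The inclusion of the coefficient ring. -/
noncomputable def NCPoly.coeff : R →+* NCPoly R A where
  toFun r := NCPoly.mk R A (FreeAlgebra.ι ℤ (Sum.inl r))
  map_one' := by
    rw [NCPoly.mk_rel R A PolyRel.one, map_one]
  map_mul' r s := by
    rw [NCPoly.mk_rel R A (PolyRel.mul r s), map_mul]
  map_add' r s := by
    rw [NCPoly.mk_rel R A (PolyRel.add r s), map_add]
  map_zero' := by
    have h := NCPoly.mk_rel R A (PolyRel.add 0 0)
    rw [map_add, add_zero] at h
    simpa using h

/-- A letter as a polynomial. -/
noncomputable def NCPoly.letter (z : Letter A) : NCPoly R A :=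
  NCPoly.mk R A (FreeAlgebra.ι ℤ (Sum.inr z))

/-- The monomials `r₁ Z₁ r₂ Z₂ ⋯ Z_l r_{l+1}` of type `Z₁ ⋯ Z_l`. -/
inductive NCPoly.IsMonomial : List (Letter A) → NCPoly R A → Prop
  | nil (r : R) : NCPoly.IsMonomial [] (NCPoly.coeff R A r)
  | cons (r : R) (z : Letter A) (w : List (Letter A)) (m : NCPoly R A) :
      NCPoly.IsMonomial w m →
      NCPoly.IsMonomial (z :: w) (NCPoly.coeff R A r * NCPoly.letter R A z * m)

/-- The homogeneous component of a word `w = Z₁ ⋯ Z_l`: the additive group generated by the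
monomials `r₁ Z₁ r₂ Z₂ ⋯ Z_l r_{l+1}` (it is isomorphic to `R ⊗_ℤ ⋯ ⊗_ℤ R`, with `l + 1` factors).
-/
noncomputable def NCPoly.component (w : List (Letter A)) : AddSubgroup (NCPoly R A) :=
  AddSubgroup.closure {m | NCPoly.IsMonomial R A w m}

/-- The universal property of the ring of polynomials. -/
noncomputable def NCPoly.eval {B : Type*} [Ring B] (c : R →+* B) (x : Letter A → B) :
    NCPoly R A →+* B :=
  RingQuot.lift ⟨(FreeAlgebra.lift ℤ (Sum.elim (fun r => c r) x)).toRingHom, by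
    intro a b h
    induction h with
    | one => simp
    | add r s => simp
    | mul r s => simp⟩

end Polynomials

section WordSeries

/-- Families of elements of a ring `S` indexed by words, written as formal series `∑_w f(w)`;
they are multiplied by concatenation of words. -/
def WordSeries (Z S : Type*) := List Z → S

variable {Z S : Type*} [Ring S]

instance : AddCommGroup (WordSeries Z S) := inferInstanceAs (AddCommGroup (List Z → S))

/-- `(f g)(w) = ∑_{w = u v} f(u) g(v)`. -/
instance : Mul (WordSeries Z S) where
  mul f g := fun w => ∑ i ∈ Finset.range (w.length + 1), f (w.take i) * g (w.drop i)

instance : One (WordSeries Z S) where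
  one := fun w => match w with
    | [] => 1
    | _ :: _ => 0

theorem WordSeries.mul_apply (f g : WordSeries Z S) (w : List Z) :
    (f * g) w = ∑ i ∈ Finset.range (w.length + 1), f (w.take i) * g (w.drop i) := rfl

theorem WordSeries.mul_nil (f g : WordSeries Z S) : (f * g) [] = f [] * g [] := by
  simp [WordSeries.mul_apply]

/-- The series obtained by removing a first letter. -/
def WordSeries.tail (z : Z) (f : WordSeries Z S) : WordSeries Z S := fun w => f (z :: w)

theorem WordSeries.mul_cons (f g : WordSeries Z S) (z : Z) (w : List Z) :
    (f * g) (z :: w) = f [] * g (z :: w) + (WordSeries.tail z f * g) w := by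
  rw [WordSeries.mul_apply, WordSeries.mul_apply, List.length_cons, Finset.sum_range_succ']
  simp [WordSeries.tail, add_comm]

theorem WordSeries.add_apply (f g : WordSeries Z S) (w : List Z) : (f + g) w = f w + g w := rfl

theorem WordSeries.mul_assoc_apply (w : List Z) : ∀ f g h : WordSeries Z S,
    (f * g * h) w = (f * (g * h)) w := by
  induction w with
  | nil => intro f g h; simp only [WordSeries.mul_nil, mul_assoc]
  | cons z w ih =>
    intro f g h
    have key : (WordSeries.tail z (f * g) * h) w =
        f [] * (WordSeries.tail z g * h) w + (WordSeries.tail z f * g * h) w := by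
      simp only [WordSeries.mul_apply (WordSeries.tail z (f * g)), WordSeries.tail,
        WordSeries.mul_cons]
      simp only [add_mul, Finset.sum_add_distrib, mul_assoc]
      rw [← Finset.mul_sum]
      rfl
    rw [WordSeries.mul_cons, WordSeries.mul_cons f, key, ih, WordSeries.mul_nil,
      WordSeries.mul_cons, mul_add, mul_assoc, add_assoc]

instance : Ring (WordSeries Z S) :=
  { (inferInstance : AddCommGroup (WordSeries Z S)),
    (inferInstance : Mul (WordSeries Z S)),
    (inferInstance : One (WordSeries Z S)) with
    left_distrib := fun f g h => by
      funext w
      simp only [WordSeries.mul_apply, WordSeries.add_apply, mul_add, Finset.sum_add_distrib]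
    right_distrib := fun f g h => by
      funext w
      simp only [WordSeries.mul_apply, WordSeries.add_apply, add_mul, Finset.sum_add_distrib]
    zero_mul := fun f => by
      funext w
      exact Finset.sum_eq_zero fun i _ => zero_mul _
    mul_zero := fun f => by
      funext w
      exact Finset.sum_eq_zero fun i _ => mul_zero _
    mul_assoc := fun f g h => funext fun w => WordSeries.mul_assoc_apply w f g h
    one_mul := fun f => by
      funext w
      rw [WordSeries.mul_apply, Finset.sum_range_succ',
        Finset.sum_eq_zero, zero_add]
      · exact one_mul _
      · intro i hi
        cases w with
        | nil => simp at hi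
        | cons z w => exact zero_mul _
    mul_one := fun f => by
      funext w
      rw [WordSeries.mul_apply, Finset.sum_range_succ, Finset.sum_eq_zero, zero_add]
      · rw [List.take_length, List.drop_length]
        exact mul_one _
      · intro i hi
        have hi' : i < w.length := Finset.mem_range.1 hi
        rw [List.drop_eq_getElem_cons hi']
        exact mul_zero _
    zsmul := fun n f => n • f
    zsmul_zero' := fun f => zero_zsmul f
    zsmul_succ' := fun n f => SubNegMonoid.zsmul_succ' n f
    zsmul_neg' := fun n f => SubNegMonoid.zsmul_neg' n f
    nsmul := fun n f => n • f
    nsmul_zero := fun f => zero_nsmul f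
    nsmul_succ := fun n f => succ_nsmul f n
    neg_add_cancel := fun f => neg_add_cancel f }

end WordSeries

section Series

variable (R : Type*) [Ring R] (A : Type*)

theorem NCPoly.coeff_mul_isMonomial (r : R) (w : List (Letter A)) (m : NCPoly R A)
    (hm : NCPoly.IsMonomial R A w m) : NCPoly.IsMonomial R A w (NCPoly.coeff R A r * m) := by
  cases hm with
  | nil s => rw [← map_mul]; exact .nil _
  | cons s z w m hm => rw [← mul_assoc, ← mul_assoc, ← map_mul]; exact .cons _ _ _ _ hm

theorem NCPoly.isMonomial_mul (u v : List (Letter A)) (m n : NCPoly R A)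
    (hm : NCPoly.IsMonomial R A u m) (hn : NCPoly.IsMonomial R A v n) :
    NCPoly.IsMonomial R A (u ++ v) (m * n) := by
  induction hm with
  | nil r => exact NCPoly.coeff_mul_isMonomial R A r v n hn
  | cons r z u m hm ih => rw [mul_assoc]; exact .cons _ _ _ _ ih

theorem NCPoly.component_mul (u v : List (Letter A)) (m n : NCPoly R A)
    (hm : m ∈ NCPoly.component R A u) (hn : n ∈ NCPoly.component R A v) :
    m * n ∈ NCPoly.component R A (u ++ v) := by
  induction hm using AddSubgroup.closure_induction with
  | mem m hm =>
    induction hn using AddSubgroup.closure_induction with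
    | mem n hn => exact AddSubgroup.subset_closure (NCPoly.isMonomial_mul R A u v m n hm hn)
    | zero => rw [mul_zero]; exact zero_mem _
    | add a b _ _ ha hb => rw [mul_add]; exact add_mem ha hb
    | neg a _ ha => rw [mul_neg]; exact neg_mem ha
  | zero => rw [zero_mul]; exact zero_mem _
  | add a b _ _ ha hb => rw [add_mul]; exact add_mem ha hb
  | neg a _ ha => rw [neg_mul]; exact neg_mem ha

theorem NCPoly.coeff_mem (r : R) : NCPoly.coeff R A r ∈ NCPoly.component R A [] :=
  AddSubgroup.subset_closure (.nil r)

/-- The ring of formal power series, as a subring of the ring of word-indexed families of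
polynomials: the families whose entry at a word `w` is homogeneous of type `w`, i.e. the (generally
infinite) formal sums of monomials `± r₁ Z₁ r₂ Z₂ ⋯ Z_l r_{l+1}`. -/
noncomputable def seriesSubring : Subring (WordSeries (Letter A) (NCPoly R A)) where
  carrier := {f | ∀ w, f w ∈ NCPoly.component R A w}
  mul_mem' := by
    intro f g hf hg w
    refine sum_mem fun i _ => ?_
    have h := NCPoly.component_mul R A (w.take i) (w.drop i) _ _ (hf (w.take i)) (hg (w.drop i))
    rwa [List.take_append_drop] at h
  one_mem' := by
    intro w
    cases w with
    | nil =>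
      have h := NCPoly.coeff_mem R A 1
      rw [map_one] at h
      exact h
    | cons z w => exact zero_mem _
  add_mem' := fun hf hg w => add_mem (hf w) (hg w)
  zero_mem' := fun w => zero_mem _
  neg_mem' := fun hf w => neg_mem (hf w)

/-- Formal power series in the noncommuting variables `X` and `Y_α`, with coefficients in `R` that
commute with no variable. -/
abbrev Series := ↥(seriesSubring R A)

end Series

namespace Series

variable {R : Type*} [Ring R] {A : Type*}

/-- The homogeneous part of a series at a word `w` (the sum of its monomials of type `w`). -/
def part (f : Series R A) (w : List (Letter A)) : NCPoly R A := f.1 w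

/-- The elements of `R` as constant series. -/
noncomputable def const : R →+* Series R A where
  toFun r := ⟨fun w => match w with
    | [] => NCPoly.coeff R A r
    | _ :: _ => 0, by
    intro w
    cases w with
    | nil => exact NCPoly.coeff_mem R A r
    | cons z w => exact zero_mem _⟩
  map_one' := by
    apply Subtype.ext
    funext w
    cases w with
    | nil => exact map_one (NCPoly.coeff R A)
    | cons z w => rfl
  map_zero' := by
    apply Subtype.ext
    funext w
    cases w with
    | nil => exact map_zero (NCPoly.coeff R A)
    | cons z w => rfl
  map_add' r s := by
    apply Subtype.ext
    funext w
    cases w with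
    | nil => exact map_add (NCPoly.coeff R A) r s
    | cons z w => exact (add_zero (0 : NCPoly R A)).symm
  map_mul' r s := by
    apply Subtype.ext
    funext w
    rw [Subring.coe_mul]
    cases w with
    | nil =>
      rw [WordSeries.mul_nil]
      exact map_mul (NCPoly.coeff R A) r s
    | cons z w =>
      rw [WordSeries.mul_apply, Finset.sum_eq_zero]
      intro i _
      cases i with
      | zero => exact mul_zero _
      | succ i => exact zero_mul _

open Classical in
/-- The letters as series. -/
noncomputable def var (z : Letter A) : Series R A :=
  ⟨fun w => if w = [z] then NCPoly.letter R A z else 0, by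
    intro w
    dsimp only
    split_ifs with h
    · subst h
      have h := NCPoly.IsMonomial.cons 1 z [] _ (NCPoly.IsMonomial.nil (R := R) (A := A) 1)
      rw [map_one, one_mul, mul_one] at h
      exact AddSubgroup.subset_closure h
    · exact zero_mem _⟩

/-- The series `X`. -/
noncomputable def X : Series R A := var Letter.X

/-- The series `Y_α`. -/
noncomputable def Y (a : A) : Series R A := var (Letter.Y a)

/-- A family of series can be summed formally: every word occurs in only finitely many members. -/
def FormallySummable {ι : Type*} (F : ι → Series R A) : Prop :=
  ∀ w, {i | (F i).part w ≠ 0}.Finite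

/-- The formal sum of a formally summable family (its entry at a word `w` is the finite sum of the
entries at `w`). -/
noncomputable def formalSum {ι : Type*} (F : ι → Series R A) : Series R A :=
  ⟨fun w => ∑ᶠ i, (F i).part w, fun w =>
    finsum_induction (· ∈ NCPoly.component R A w) (zero_mem _)
      (fun _ _ => add_mem) (fun i => (F i).2 w)⟩

/-- Every monomial of `f` has degree at least `1` in `X`. -/
def PosOrder (f : Series R A) : Prop := ∀ w, xdeg w = 0 → f.part w = 0

/-- `f = p + (terms of degree > n in X)`. -/
def EqUpTo (n : ℕ) (f p : Series R A) : Prop := ∀ w, xdeg w ≤ n → f.part w = p.part w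

/-- The letters after the substitution of `h` for `X`. -/
noncomputable def substLetter (h : Series R A) : Letter A → Series R A
  | Letter.X => h
  | Letter.Y a => Y a

/-- The series obtained from a polynomial by replacing every occurrence of `X` in every monomial by
the series `h`, and leaving the elements of `R` and the `Y_α` as they are. -/
noncomputable def subst (h : Series R A) : NCPoly R A →+* Series R A :=
  NCPoly.eval R A const (substLetter h)

/-- The composition `f ∘_X h` is defined: every monomial of `h` has degree at least `1` in `X`, and
the substitution of `h` for `X` in all monomials of `f` yields a formally summable family. -/
def Composable (f h : Series R A) : Prop :=
  PosOrder h ∧ FormallySummable fun u : List (Letter A) => subst h (f.part u)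

/-- The composition `f ∘_X h`: every occurrence of `X` in every monomial of `f` is replaced by
`h`. -/
noncomputable def comp (f h : Series R A) : Series R A :=
  formalSum fun u : List (Letter A) => subst h (f.part u)

/-- The coordinate `(M V)_α = ∑_β M(α,β) V_β` of the product of a matrix with a column vector. -/
noncomputable def matVec (M : Matrix A A R) (V : A → Series R A) (a : A) : Series R A :=
  formalSum fun b => const (M a b) * V b

/-- The family `g_α = Y_α X^k + (terms of higher order in X)` satisfies
`g_α = Y_α (X - (M₁ V)_α) ⋯ (X - (M_k V)_α)`, where `V = (g_β)_β`. -/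
def IsSolution {k : ℕ} (M : Fin k → Matrix A A R) (V : A → Series R A) : Prop :=
  ∀ a, EqUpTo k (V a) (Y a * X ^ k) ∧
    V a = Y a * (List.ofFn fun j => X - matVec (M j) V a).prod

/-- The matrices `J - M_j`, where `J` is the all `1` matrix. -/
def complementary {k : ℕ} (M : Fin k → Matrix A A R) (j : Fin k) : Matrix A A R :=
  Matrix.of fun a b => 1 - M j a b

/-- The family `g̃_α = Y_α (-X)^k + (terms of higher order in X)` satisfies
`g̃_α = Y_α (-X + (N₁ V)_α) ⋯ (-X + (N_k V)_α)`, where `V = (g̃_β)_β`; it will be used for the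
complementary matrices `N_j = J - M_j`. -/
def IsDualSolution {k : ℕ} (N : Fin k → Matrix A A R) (V : A → Series R A) : Prop :=
  ∀ a, EqUpTo k (V a) (Y a * (-X) ^ k) ∧
    V a = Y a * (List.ofFn fun j => -X + matVec (N j) V a).prod

/-- The series `-X + ∑_α V_α`. -/
noncomputable def total (V : A → Series R A) : Series R A := -X + formalSum V

end Series

/-! Both systems have the shape `V a = Y a * ∏ (c + (N_j V)_a)`, i.e. `step c N V = V`: with `c =
X`, `N_j = -M_j` for the first and `c = -X`, `N_j = J - M_j` for the second. The prefix `Y a` makes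
`step` a contraction for word length, so for every series `c` there is exactly one fixed point
(`exists_step_fixedPoint`, `step_fixedPoint_unique`). The prescribed leading terms follow from the
equation itself once `k ≥ 2` (`eqUpTo_of_step_fixedPoint`).

Substituting `h` for `X` is a ring homomorphism that fixes `R` and the `Y a` and commutes with
formal sums (`comp_mul`, `comp_formalSum`). It therefore carries the fixed point for `c` to the
fixed point for `c ∘ h` with the same matrices (`comp_step_fixedPoint`).

Let `h = -X + ∑ W_β`. Since `-X + (J - M_j) W = h - M_j W`, the family `W` also solves the first
system with `X` replaced by `h`. Uniqueness gives `V_α ∘ h = W_α`, and summing over `α` gives `g ∘ h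
= -h + ∑ W_α = X`. The other composition is symmetric. -/

namespace NCPoly

variable {R : Type*} [Ring R] {A : Type*} {B : Type*} [Ring B]

@[simp]
theorem eval_coeff (c : R →+* B) (x : Letter A → B) (r : R) :
    eval R A c x (coeff R A r) = c r := by
  change RingQuot.lift _ (RingQuot.mkRingHom _ _) = _
  rw [RingQuot.lift_mkRingHom_apply]
  simp

@[simp]
theorem eval_letter (c : R →+* B) (x : Letter A → B) (z : Letter A) :
    eval R A c x (letter R A z) = x z := by
  change RingQuot.lift _ (RingQuot.mkRingHom _ _) = _
  rw [RingQuot.lift_mkRingHom_apply]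
  simp

end NCPoly

theorem xdeg_append {A : Type*} (u v : List (Letter A)) : xdeg (u ++ v) = xdeg u + xdeg v := by
  induction u with
  | nil => simp [xdeg]
  | cons z u ih => cases z <;> simp [xdeg, ih, Nat.add_right_comm]

/-- A sum over all factorizations of the words of a finite set is a product of sums, if the set
contains all words that contribute to it. -/
theorem sum_take_mul_drop {Z S : Type*} [Ring S] (C : Finset (List Z)) (a b : List Z → S)
    (ha : Function.support a ⊆ C) (hb : Function.support b ⊆ C)
    (hab : ∀ u v, a u ≠ 0 → b v ≠ 0 → u ++ v ∈ C) :
    ∑ u ∈ C, ∑ i ∈ Finset.range (u.length + 1), a (u.take i) * b (u.drop i) =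
      (∑ᶠ u, a u) * ∑ᶠ v, b v := by
  rw [finsum_eq_sum_of_support_subset a ha, finsum_eq_sum_of_support_subset b hb,
    Finset.sum_mul_sum, Finset.sum_sigma', ← Finset.sum_product']
  refine Finset.sum_bij_ne_zero (fun p _ _ => (p.1.take p.2, p.1.drop p.2)) ?_ ?_ ?_ ?_
  · rintro ⟨u, i⟩ - h
    exact Finset.mem_product.2 ⟨ha (left_ne_zero_of_mul h), hb (right_ne_zero_of_mul h)⟩
  · rintro ⟨u, i⟩ hu - ⟨v, j⟩ hv - h
    simp only [Finset.mem_sigma, Finset.mem_range] at hu hv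
    simp only [Prod.mk.injEq] at h
    obtain rfl : u = v := by
      rw [← List.take_append_drop i u, h.1, h.2, List.take_append_drop]
    have hl := congrArg List.length h.1
    simp only [List.length_take] at hl
    obtain rfl : i = j := by omega
    rfl
  · rintro ⟨u, v⟩ - h
    refine ⟨⟨u ++ v, u.length⟩, ?_, ?_, ?_⟩
    · simpa using hab u v (left_ne_zero_of_mul h) (right_ne_zero_of_mul h)
    · simpa using h
    · simp
  · intro _ _ _
    rfl

/-! ### Homogeneous parts of series. -/

namespace Series

variable {R : Type*} [Ring R] {A : Type*}

theorem ext_part {f g : Series R A} (h : ∀ w, f.part w = g.part w) : f = g :=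
  Subtype.ext (funext h)

@[simp]
theorem part_zero (w : List (Letter A)) : (0 : Series R A).part w = 0 := rfl

@[simp]
theorem part_add (f g : Series R A) (w : List (Letter A)) :
    (f + g).part w = f.part w + g.part w := rfl

@[simp]
theorem part_neg (f : Series R A) (w : List (Letter A)) : (-f).part w = -f.part w := rfl

@[simp]
theorem part_sub (f g : Series R A) (w : List (Letter A)) :
    (f - g).part w = f.part w - g.part w := by
  rw [sub_eq_add_neg, part_add, part_neg, ← sub_eq_add_neg]

theorem part_mul (f g : Series R A) (w : List (Letter A)) :
    (f * g).part w =
      ∑ i ∈ Finset.range (w.length + 1), f.part (w.take i) * g.part (w.drop i) := rfl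

/-- Taking the homogeneous part at a word, as an additive homomorphism. -/
def partHom (w : List (Letter A)) : Series R A →+ NCPoly R A where
  toFun f := f.part w
  map_zero' := rfl
  map_add' _ _ := rfl

theorem part_sum {ι : Type*} (s : Finset ι) (F : ι → Series R A) (w : List (Letter A)) :
    (∑ i ∈ s, F i).part w = ∑ i ∈ s, (F i).part w :=
  map_sum (partHom w) F s

theorem part_formalSum {ι : Type*} (F : ι → Series R A) (w : List (Letter A)) :
    (formalSum F).part w = ∑ᶠ i, (F i).part w := rfl

theorem part_const_nil (r : R) : (const r : Series R A).part [] = NCPoly.coeff R A r := rfl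

theorem part_const_of_ne_nil (r : R) {w : List (Letter A)} (hw : w ≠ []) :
    (const r : Series R A).part w = 0 := by
  cases w with
  | nil => exact absurd rfl hw
  | cons z w => rfl

open Classical in
theorem part_var (z : Letter A) (w : List (Letter A)) :
    (var z : Series R A).part w = if w = [z] then NCPoly.letter R A z else 0 := rfl

theorem part_const_mul (r : R) (f : Series R A) (w : List (Letter A)) :
    (const r * f).part w = NCPoly.coeff R A r * f.part w := by
  rw [part_mul, Finset.sum_eq_single 0]
  · rfl
  · intro i hi h0
    rw [part_const_of_ne_nil, zero_mul]
    rw [Finset.mem_range] at hi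
    intro h
    have := congrArg List.length h
    simp only [List.length_take, List.length_nil] at this
    omega
  · intro h
    simp at h

theorem exists_of_part_mul_ne_zero {f g : Series R A} {w : List (Letter A)}
    (h : (f * g).part w ≠ 0) : ∃ u v, u ++ v = w ∧ f.part u ≠ 0 ∧ g.part v ≠ 0 := by
  rw [part_mul] at h
  obtain ⟨i, -, hi⟩ := Finset.exists_ne_zero_of_sum_ne_zero h
  exact ⟨_, _, List.take_append_drop i w, left_ne_zero_of_mul hi, right_ne_zero_of_mul hi⟩

theorem eq_of_part_var_ne_zero {z : Letter A} {w : List (Letter A)}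
    (h : (var z : Series R A).part w ≠ 0) : w = [z] := by
  by_contra hw
  exact h (if_neg hw)

/-! ### Filtrations by an additive degree on words. -/

/-- The series whose monomials all have degree at least `n`, for a degree function `d`. -/
def vanishing (R : Type*) [Ring R] {A : Type*} (d : List (Letter A) → ℕ) (n : ℕ) :
    AddSubgroup (Series R A) where
  carrier := {f | ∀ w, d w < n → f.part w = 0}
  zero_mem' := fun _ _ => rfl
  add_mem' := fun hf hg w hw => by rw [part_add, hf w hw, hg w hw, add_zero]
  neg_mem' := fun hf w hw => by rw [part_neg, hf w hw, neg_zero]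

theorem mem_vanishing {d : List (Letter A) → ℕ} {n : ℕ} {f : Series R A} :
    f ∈ vanishing R d n ↔ ∀ w, d w < n → f.part w = 0 := Iff.rfl

theorem vanishing_anti (d : List (Letter A) → ℕ) {m n : ℕ} (h : m ≤ n) :
    vanishing R d n ≤ vanishing R d m := fun _ hf w hw => hf w (hw.trans_le h)

theorem mem_vanishing_zero (d : List (Letter A) → ℕ) (f : Series R A) : f ∈ vanishing R d 0 :=
  fun _ hw => absurd hw (Nat.not_lt_zero _)

theorem var_mem_vanishing (d : List (Letter A) → ℕ) (z : Letter A) :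
    (var z : Series R A) ∈ vanishing R d (d [z]) := by
  intro w hw
  by_contra h
  rw [eq_of_part_var_ne_zero h] at hw
  exact lt_irrefl _ hw

theorem mul_mem_vanishing {d : List (Letter A) → ℕ} (hd : ∀ u v, d (u ++ v) = d u + d v)
    {m n : ℕ} {f g : Series R A} (hf : f ∈ vanishing R d m) (hg : g ∈ vanishing R d n) :
    f * g ∈ vanishing R d (m + n) := by
  intro w hw
  by_contra h
  obtain ⟨u, v, rfl, hu, hv⟩ := exists_of_part_mul_ne_zero h
  have h1 : m ≤ d u := not_lt.1 fun h => hu (hf u h)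
  have h2 : n ≤ d v := not_lt.1 fun h => hv (hg v h)
  rw [hd] at hw
  omega

theorem formalSum_mem_vanishing {d : List (Letter A) → ℕ} {n : ℕ} {ι : Type*}
    {F : ι → Series R A} (hF : ∀ i, F i ∈ vanishing R d n) : formalSum F ∈ vanishing R d n := by
  intro w hw
  rw [part_formalSum]
  exact finsum_eq_zero_of_forall_eq_zero fun i => hF i w hw

theorem prod_ofFn_mem_vanishing {d : List (Letter A) → ℕ} (hd : ∀ u v, d (u ++ v) = d u + d v)
    {m k : ℕ} {f : Fin k → Series R A} (hf : ∀ j, f j ∈ vanishing R d m) :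
    (List.ofFn f).prod ∈ vanishing R d (k * m) := by
  induction k with
  | zero => rw [Nat.zero_mul]; exact mem_vanishing_zero _ _
  | succ k ih =>
    rw [List.ofFn_succ, List.prod_cons, Nat.succ_mul, Nat.add_comm]
    exact mul_mem_vanishing hd (hf 0) (ih fun j => hf j.succ)

/-- Telescoping: changing one factor at a time, the changed factor contributes `m + n` and each of
the others `m`. It serves word length (`m = 0`) for contraction and the degree in `X` (`m = n = 1`)
for the leading term. -/
theorem prod_ofFn_sub_mem_vanishing {d : List (Letter A) → ℕ}
    (hd : ∀ u v, d (u ++ v) = d u + d v) {m n k : ℕ} {f g : Fin k → Series R A}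
    (hf : ∀ j, f j ∈ vanishing R d m) (hg : ∀ j, g j ∈ vanishing R d m)
    (hfg : ∀ j, f j - g j ∈ vanishing R d (m + n)) :
    (List.ofFn f).prod - (List.ofFn g).prod ∈ vanishing R d (k * m + n) := by
  induction k with
  | zero => simp [zero_mem]
  | succ k ih =>
    simp only [List.ofFn_succ, List.prod_cons]
    rw [← sub_add_sub_cancel _ (f 0 * (List.ofFn fun j : Fin k => g j.succ).prod), ← mul_sub,
      ← sub_mul]
    have h1 := mul_mem_vanishing hd (hf 0)
      (ih (fun j => hf j.succ) (fun j => hg j.succ) fun j => hfg j.succ)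
    have h2 := mul_mem_vanishing hd (hfg 0) (prod_ofFn_mem_vanishing hd fun j => hg j.succ)
    rw [show (k + 1) * m + n = m + (k * m + n) by ring]
    refine add_mem h1 ?_
    rwa [show m + (k * m + n) = m + n + k * m by ring]

/-! ### Matrices acting on families of series. -/

theorem part_matVec (M : Matrix A A R) (V : A → Series R A) (a : A) (w : List (Letter A)) :
    (matVec M V a).part w = ∑ᶠ b, NCPoly.coeff R A (M a b) * (V b).part w :=
  finsum_congr fun b => part_const_mul (M a b) (V b) w

theorem matVec_neg (M : Matrix A A R) (V : A → Series R A) (a : A) :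
    matVec (-M) V a = -matVec M V a := by
  refine ext_part fun w => ?_
  rw [part_neg, part_matVec, part_matVec, ← finsum_neg_distrib]
  refine finsum_congr fun b => ?_
  rw [Matrix.neg_apply, map_neg, neg_mul]

theorem matVec_sub_mem_vanishing {d : List (Letter A) → ℕ} {n : ℕ} (M : Matrix A A R)
    {V W : A → Series R A} (h : ∀ a, V a - W a ∈ vanishing R d n) (a : A) :
    matVec M V a - matVec M W a ∈ vanishing R d n := by
  intro w hw
  rw [part_sub, part_matVec, part_matVec, sub_eq_zero]
  -- The two `finsum`s agree term by term, so no summability of `V` or `W` is needed; hence `step`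
  -- contracts on arbitrary families, even where a `finsum` takes its default value `0`.
  refine finsum_congr fun b => ?_
  rw [sub_eq_zero.1 ((part_sub (V b) (W b) w).symm.trans (h b w hw))]

theorem matVec_mem_vanishing {d : List (Letter A) → ℕ} {n : ℕ} (M : Matrix A A R)
    {V : A → Series R A} (h : ∀ a, V a ∈ vanishing R d n) (a : A) :
    matVec M V a ∈ vanishing R d n := by
  intro w hw
  rw [part_matVec]
  refine finsum_eq_zero_of_forall_eq_zero fun b => ?_
  rw [h b w hw, mul_zero]

theorem FormallySummable.const_mul {V : A → Series R A} (hV : FormallySummable V)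
    (r : A → R) : FormallySummable fun b => const (r b) * V b := by
  refine fun w => (hV w).subset fun b hb h => hb ?_
  change (const (r b) * V b).part w = 0
  rw [part_const_mul, h, mul_zero]

theorem matVec_complementary {k : ℕ} (M : Fin k → Matrix A A R) (j : Fin k)
    {V : A → Series R A} (hV : FormallySummable V) (a : A) :
    matVec (complementary M j) V a = formalSum V - matVec (M j) V a := by
  refine ext_part fun w => ?_
  rw [part_sub, part_matVec, part_formalSum, part_matVec, ← finsum_sub_distrib (hV w)]
  · refine finsum_congr fun b => ?_
    simp [complementary, sub_mul]
  · refine (hV w).subset fun b hb h => hb ?_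
    change NCPoly.coeff R A (M j a b) * (V b).part w = 0
    rw [h, mul_zero]

/-! ### Fixed points of `step`. -/

/-- The right hand side of the equation `V_α = Y_α (c + (N₁ V)_α) ⋯ (c + (N_k V)_α)`. -/
noncomputable def step {k : ℕ} (c : Series R A) (N : Fin k → Matrix A A R)
    (V : A → Series R A) (a : A) : Series R A :=
  Y a * (List.ofFn fun j => c + matVec (N j) V a).prod

/-- The first letter of a word determines the only index that can contribute to it, so an infinite
alphabet causes no trouble. -/
theorem formallySummable_of_eq_Y_mul {V P : A → Series R A} (h : ∀ a, V a = Y a * P a) :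
    FormallySummable V := by
  have key : ∀ a w, (V a).part w ≠ 0 → w.head? = some (Letter.Y a) := by
    intro a w hw
    rw [h] at hw
    obtain ⟨u, v, rfl, hu, -⟩ := exists_of_part_mul_ne_zero hw
    rw [eq_of_part_var_ne_zero hu]
    rfl
  refine fun w => Set.Subsingleton.finite fun a ha b hb => ?_
  have := (key a w ha).symm.trans (key b w hb)
  simpa using this

theorem step_sub_mem_vanishing {k : ℕ} (c : Series R A) (N : Fin k → Matrix A A R) {n : ℕ}
    {V W : A → Series R A} (h : ∀ a, V a - W a ∈ vanishing R List.length n) (a : A) :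
    step c N V a - step c N W a ∈ vanishing R List.length (n + 1) := by
  have hd : ∀ u v : List (Letter A), (u ++ v).length = u.length + v.length :=
    fun u v => List.length_append
  rw [step, step, ← mul_sub, Nat.add_comm]
  refine mul_mem_vanishing hd (var_mem_vanishing List.length _) ?_
  have := prod_ofFn_sub_mem_vanishing (R := R) hd (m := 0) (n := n)
    (f := fun j => c + matVec (N j) V a) (g := fun j => c + matVec (N j) W a)
    (fun _ => mem_vanishing_zero _ _) (fun _ => mem_vanishing_zero _ _) fun j => by
      rw [Nat.zero_add, add_sub_add_left_eq_sub]
      exact matVec_sub_mem_vanishing (N j) h a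
  rwa [Nat.mul_zero, Nat.zero_add] at this

theorem eq_of_forall_sub_mem_vanishing {f g : Series R A}
    (h : ∀ n, f - g ∈ vanishing R List.length n) : f = g :=
  ext_part fun w => sub_eq_zero.1 (h (w.length + 1) w (Nat.lt_succ_self _))

theorem step_fixedPoint_unique {k : ℕ} {c : Series R A} {N : Fin k → Matrix A A R}
    {V W : A → Series R A} (hV : step c N V = V) (hW : step c N W = W) : V = W := by
  have key : ∀ n a, V a - W a ∈ vanishing R List.length n := by
    intro n
    induction n with
    | zero => exact fun a => mem_vanishing_zero _ _
    | succ n ih =>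
      intro a
      have := step_sub_mem_vanishing c N ih a
      rwa [hV, hW] at this
  exact funext fun a => eq_of_forall_sub_mem_vanishing fun n => key n a

theorem exists_step_fixedPoint {k : ℕ} (c : Series R A) (N : Fin k → Matrix A A R) :
    ∃ V, step c N V = V := by
  let I : ℕ → A → Series R A := fun n => (step c N)^[n] 0
  have hI : ∀ n, I (n + 1) = step c N (I n) := fun n => Function.iterate_succ_apply' _ _ _
  have hsucc : ∀ n a, I (n + 1) a - I n a ∈ vanishing R List.length n := by
    intro n
    induction n with
    | zero => exact fun a => mem_vanishing_zero _ _
    | succ n ih =>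
      intro a
      rw [hI (n + 1)]
      nth_rw 2 [hI n]
      exact step_sub_mem_vanishing c N ih a
  have hle : ∀ m n a, m ≤ n → I n a - I m a ∈ vanishing R List.length m := by
    intro m n a hmn
    induction n, hmn using Nat.le_induction with
    | base => rw [sub_self]; exact zero_mem _
    | succ n hmn ih =>
      rw [← sub_add_sub_cancel _ (I n a)]
      exact add_mem (vanishing_anti _ hmn (hsucc n a)) ih
  -- By `hle`, the part at `w` no longer changes from iterate `w.length + 1` on.
  let V : A → Series R A := fun a =>
    ⟨fun w => (I (w.length + 1) a).part w, fun w => (I (w.length + 1) a).2 w⟩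
  have hV : ∀ n a, V a - I n a ∈ vanishing R List.length n := by
    intro n a w hw
    have h := hle (w.length + 1) n a hw w (Nat.lt_succ_self _)
    rw [part_sub, sub_eq_zero] at h ⊢
    exact h.symm
  refine ⟨V, funext fun a => eq_of_forall_sub_mem_vanishing fun n => ?_⟩
  rw [← sub_sub_sub_cancel_right _ _ (I (n + 1) a)]
  refine vanishing_anti _ (Nat.le_succ n) (sub_mem ?_ (hV (n + 1) a))
  rw [hI]
  exact step_sub_mem_vanishing c N (hV n) a

theorem mem_vanishing_of_step_fixedPoint {k : ℕ} {c : Series R A}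
    {N : Fin k → Matrix A A R} {V : A → Series R A} (hk : 0 < k)
    (hc : c ∈ vanishing R xdeg 1) (hV : step c N V = V) (a : A) :
    V a ∈ vanishing R xdeg k := by
  -- The equation alone does not visibly bound the degree in `X`, but the iterates from `0` satisfy
  -- the bound and converge to `V` in word length.
  have hstep : ∀ n a, (step c N)^[n] 0 a ∈ vanishing R xdeg k := by
    intro n
    induction n with
    | zero => exact fun a => zero_mem _
    | succ n ih =>
      intro a
      rw [Function.iterate_succ_apply']
      have h := mul_mem_vanishing xdeg_append (mem_vanishing_zero _ (Y a))
        (prod_ofFn_mem_vanishing xdeg_append fun j =>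
          add_mem hc (vanishing_anti _ hk (matVec_mem_vanishing (N j) ih a)))
      rwa [Nat.zero_add, Nat.mul_one] at h
  have happrox : ∀ n a, V a - (step c N)^[n] 0 a ∈ vanishing R List.length n := by
    intro n
    induction n with
    | zero => exact fun a => mem_vanishing_zero _ _
    | succ n ih =>
      intro a
      have h := step_sub_mem_vanishing c N ih a
      rwa [hV, ← Function.iterate_succ_apply' (step c N)] at h
  intro w hw
  have h := happrox (w.length + 1) a w (Nat.lt_succ_self _)
  rw [part_sub, sub_eq_zero] at h
  rw [h, hstep _ a w hw]

theorem eqUpTo_of_step_fixedPoint {k : ℕ} {c : Series R A}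
    {N : Fin k → Matrix A A R} {V : A → Series R A} (hk : 2 ≤ k)
    (hc : c ∈ vanishing R xdeg 1) (hV : step c N V = V) (a : A) :
    EqUpTo k (V a) (Y a * c ^ k) := by
  -- Here `k ≥ 2` matters: each factor `c + (N_j V)_a` differs from `c` only in degree at least `2`
  -- in `X`.
  have hVk : ∀ a, V a ∈ vanishing R xdeg 2 := fun a =>
    vanishing_anti _ hk (mem_vanishing_of_step_fixedPoint (by omega) hc hV a)
  have h : V a - Y a * c ^ k ∈ vanishing R xdeg (0 + (k * 1 + 1)) := by
    rw [← congrFun hV a, step, ← List.prod_replicate, ← List.ofFn_const, ← mul_sub]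
    refine mul_mem_vanishing xdeg_append (mem_vanishing_zero _ _)
      (prod_ofFn_sub_mem_vanishing xdeg_append (fun j => ?_) (fun _ => hc) fun j => ?_)
    · exact add_mem hc (vanishing_anti _ one_le_two (matVec_mem_vanishing (N j) hVk a))
    · rw [add_sub_cancel_left]
      exact matVec_mem_vanishing (N j) hVk a
  intro w hw
  exact sub_eq_zero.1 ((part_sub _ _ _).symm.trans (h w (by omega)))

theorem X_mem_vanishing : (X : Series R A) ∈ vanishing R xdeg 1 :=
  var_mem_vanishing xdeg Letter.X

theorem isSolution_iff {k : ℕ} (hk : 2 ≤ k) (M : Fin k → Matrix A A R) (V : A → Series R A) :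
    IsSolution M V ↔ step X (fun j => -M j) V = V := by
  have h : ∀ a, step X (fun j => -M j) V a =
      Y a * (List.ofFn fun j => X - matVec (M j) V a).prod := by
    intro a
    simp only [step, matVec_neg, ← sub_eq_add_neg]
  refine ⟨fun hV => funext fun a => (h a).trans (hV a).2.symm, fun hV a => ⟨?_, ?_⟩⟩
  · exact eqUpTo_of_step_fixedPoint hk X_mem_vanishing hV a
  · rw [← h, hV]

theorem isDualSolution_iff {k : ℕ} (hk : 2 ≤ k) (N : Fin k → Matrix A A R)
    (V : A → Series R A) : IsDualSolution N V ↔ step (-X) N V = V :=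
  ⟨fun hV => funext fun a => (hV a).2.symm, fun hV a =>
    ⟨eqUpTo_of_step_fixedPoint hk (neg_mem X_mem_vanishing) hV a, (congrFun hV a).symm⟩⟩

theorem existsUnique_step_fixedPoint {k : ℕ} (c : Series R A) (N : Fin k → Matrix A A R) :
    ∃! V, step c N V = V := by
  obtain ⟨V, hV⟩ := exists_step_fixedPoint c N
  exact ⟨V, hV, fun W hW => step_fixedPoint_unique hW hV⟩

theorem formallySummable_of_step_fixedPoint {k : ℕ} {c : Series R A}
    {N : Fin k → Matrix A A R} {V : A → Series R A} (hV : step c N V = V) :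
    FormallySummable V :=
  formallySummable_of_eq_Y_mul fun a => (congrFun hV a).symm

theorem posOrder_total {V : A → Series R A} (hV : ∀ a, V a ∈ vanishing R xdeg 1) :
    PosOrder (total V) := by
  intro w hw
  exact add_mem (neg_mem X_mem_vanishing) (formalSum_mem_vanishing hV) w (by omega)

/-! ### Finiteness of substitution. -/

/-- The words whose letters other than `X` occur in `w`, and which are not longer than `w`. -/
def refinable (w : List (Letter A)) : Set (List (Letter A)) :=
  {u | u.length ≤ w.length ∧ ∀ z ∈ u, z = Letter.X ∨ z ∈ w}

theorem refinable_finite (w : List (Letter A)) : (refinable w).Finite := by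
  let s : Set (Letter A) := {z | z = Letter.X ∨ z ∈ w}
  have hs : s.Finite := (Set.finite_singleton Letter.X).union w.finite_toSet
  have := hs.to_subtype
  refine ((List.finite_length_le s w.length).image (List.map Subtype.val)).subset ?_
  rintro u ⟨hl, hu⟩
  lift u to List s using hu
  exact ⟨u, by simpa using hl, rfl⟩

theorem append_mem_refinable {u v w x : List (Letter A)} (hu : u ∈ refinable w)
    (hv : v ∈ refinable x) : u ++ v ∈ refinable (w ++ x) := by
  refine ⟨?_, fun z hz => ?_⟩
  · rw [List.length_append, List.length_append]
    exact Nat.add_le_add hu.1 hv.1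
  · rw [List.mem_append] at hz ⊢
    rcases hz with hz | hz
    · exact (hu.2 z hz).imp_right Or.inl
    · exact (hv.2 z hz).imp_right Or.inr

theorem refinable_subset_append_right (w x : List (Letter A)) :
    refinable w ⊆ refinable (w ++ x) := fun u hu =>
  ⟨hu.1.trans (by simp), fun z hz => (hu.2 z hz).imp_right (List.mem_append_left x)⟩

theorem refinable_subset_append_left (w x : List (Letter A)) :
    refinable x ⊆ refinable (w ++ x) := fun u hu =>
  ⟨hu.1.trans (by simp), fun z hz => (hu.2 z hz).imp_right (List.mem_append_right w)⟩

@[simp]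
theorem subst_coeff (h : Series R A) (r : R) : subst h (NCPoly.coeff R A r) = const r :=
  NCPoly.eval_coeff _ _ r

@[simp]
theorem subst_letter (h : Series R A) (z : Letter A) :
    subst h (NCPoly.letter R A z) = substLetter h z :=
  NCPoly.eval_letter _ _ z

theorem singleton_mem_refinable {h : Series R A} (hh : PosOrder h) {z : Letter A}
    {w : List (Letter A)} (hw : (substLetter h z).part w ≠ 0) : [z] ∈ refinable w := by
  cases z with
  | X =>
    refine ⟨?_, by simp⟩
    cases w with
    | nil => exact absurd (hh [] rfl) hw
    | cons z w => simp
  | Y a =>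
    obtain rfl : w = [Letter.Y a] := eq_of_part_var_ne_zero hw
    exact ⟨le_rfl, by simp⟩

/-- Substitution keeps every `Y a` and replaces each `X` by nonempty words, since `h` has no
constant term. So letters other than `X` survive and the length cannot drop. -/
theorem mem_refinable_of_isMonomial {h : Series R A} (hh : PosOrder h)
    {u : List (Letter A)} {m : NCPoly R A} (hm : NCPoly.IsMonomial R A u m) :
    ∀ w, (subst h m).part w ≠ 0 → u ∈ refinable w := by
  induction hm with
  | nil r => exact fun w _ => ⟨by simp, by simp⟩
  | cons r z u m _ ih =>
    intro w hw
    rw [map_mul, map_mul, subst_coeff, subst_letter, mul_assoc, part_const_mul] at hw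
    obtain ⟨w₁, w₂, rfl, h₁, h₂⟩ := exists_of_part_mul_ne_zero (right_ne_zero_of_mul hw)
    exact append_mem_refinable (singleton_mem_refinable hh h₁) (ih w₂ h₂)

theorem mem_refinable_of_component {h : Series R A} (hh : PosOrder h)
    {u : List (Letter A)} {m : NCPoly R A} (hm : m ∈ NCPoly.component R A u)
    {w : List (Letter A)} (hw : (subst h m).part w ≠ 0) : u ∈ refinable w := by
  by_contra hu
  refine hw ?_
  clear hw
  induction hm using AddSubgroup.closure_induction with
  | mem m hm => exact not_not.1 fun h' => hu (mem_refinable_of_isMonomial hh hm w h')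
  | zero => rw [map_zero, part_zero]
  | add a b _ _ ha hb =>
    rw [map_add, part_add, ha, hb, add_zero]
  | neg a _ ha => rw [map_neg, part_neg, ha, neg_zero]

theorem mem_refinable_of_subst_part {h : Series R A} (hh : PosOrder h) (f : Series R A)
    {u w : List (Letter A)} (hw : (subst h (f.part u)).part w ≠ 0) : u ∈ refinable w :=
  mem_refinable_of_component hh (f.2 u) hw

theorem composable_of_posOrder (f : Series R A) {h : Series R A} (hh : PosOrder h) :
    Composable f h :=
  ⟨hh, fun w => (refinable_finite w).subset fun _ hu => mem_refinable_of_subst_part hh f hu⟩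

theorem part_comp_eq_sum (f : Series R A) {h : Series R A} (hh : PosOrder h)
    (w : List (Letter A)) :
    (comp f h).part w = ∑ u ∈ (refinable_finite w).toFinset, (subst h (f.part u)).part w :=
  finsum_eq_sum_of_support_subset _ fun _ hu =>
    (refinable_finite w).mem_toFinset.2 (mem_refinable_of_subst_part hh f hu)

/-! ### Composition as a homomorphism compatible with formal sums. -/

theorem comp_add (f g : Series R A) {h : Series R A} (hh : PosOrder h) :
    comp (f + g) h = comp f h + comp g h := by
  refine ext_part fun w => ?_
  rw [part_add, part_comp_eq_sum _ hh, part_comp_eq_sum _ hh, part_comp_eq_sum _ hh,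
    ← Finset.sum_add_distrib]
  simp only [part_add, map_add]

theorem comp_mul (f g : Series R A) {h : Series R A} (hh : PosOrder h) :
    comp (f * g) h = comp f h * comp g h := by
  refine ext_part fun w => ?_
  rw [part_comp_eq_sum _ hh, part_mul]
  simp only [part_mul f g, map_sum, map_mul, part_sum, part_mul (subst h _)]
  -- The sum over the splittings of `w` is moved outermost; for a fixed splitting, the sum over `u`
  -- and its splittings must factor.
  simp only [Finset.sum_comm (s := Finset.range (List.length _ + 1))
    (t := Finset.range (w.length + 1))]
  rw [Finset.sum_comm]
  refine Finset.sum_congr rfl fun j _ => ?_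
  have hw := List.take_append_drop j w
  refine sum_take_mul_drop (refinable_finite w).toFinset
    (fun u => (subst h (f.part u)).part (w.take j))
    (fun u => (subst h (g.part u)).part (w.drop j)) ?_ ?_ ?_
  · intro u hu
    rw [Set.Finite.coe_toFinset, ← hw]
    exact refinable_subset_append_right _ _ (mem_refinable_of_subst_part hh f hu)
  · intro u hu
    rw [Set.Finite.coe_toFinset, ← hw]
    exact refinable_subset_append_left _ _ (mem_refinable_of_subst_part hh g hu)
  · intro u v hu hv
    rw [Set.Finite.mem_toFinset, ← hw]
    exact append_mem_refinable (mem_refinable_of_subst_part hh f hu)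
      (mem_refinable_of_subst_part hh g hv)

theorem comp_const (r : R) (h : Series R A) : comp (const r) h = const r := by
  refine ext_part fun w => ?_
  rw [comp, part_formalSum, finsum_eq_single _ []]
  · rw [part_const_nil, subst_coeff]
  · intro u hu
    rw [part_const_of_ne_nil r hu, map_zero, part_zero]

theorem comp_var (z : Letter A) (h : Series R A) : comp (var z) h = substLetter h z := by
  refine ext_part fun w => ?_
  rw [comp, part_formalSum, finsum_eq_single _ [z]]
  · rw [part_var, if_pos rfl, subst_letter]
  · intro u hu
    rw [part_var, if_neg hu, map_zero, part_zero]

/-- Composition with a series without constant term in `X`, as a ring homomorphism. -/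
noncomputable def compHom {h : Series R A} (hh : PosOrder h) : Series R A →+* Series R A :=
  RingHom.mk' ⟨⟨fun f => comp f h, by
    rw [← map_one (const : R →+* Series R A), comp_const]⟩, fun f g => comp_mul f g hh⟩
    fun f g => comp_add f g hh

theorem compHom_apply {h : Series R A} (hh : PosOrder h) (f : Series R A) :
    compHom hh f = comp f h := rfl

theorem comp_formalSum {ι : Type*} {F : ι → Series R A} (hF : FormallySummable F)
    {h : Series R A} (hh : PosOrder h) :
    comp (formalSum F) h = formalSum fun i => comp (F i) h := by
  refine ext_part fun w => ?_
  rw [part_comp_eq_sum _ hh, part_formalSum]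
  simp only [part_comp_eq_sum _ hh]
  have hsub : ∀ u, (Function.support fun i => (subst h ((F i).part u)).part w) ⊆
      {i | (F i).part u ≠ 0} := by
    intro u i hi h0
    exact hi (by simp only [h0, map_zero, part_zero])
  -- Only the finitely many `u` in `refinable w` matter, and each meets finitely many `i`, so the
  -- two sums may be exchanged.
  rw [finsum_sum_comm _ _ fun u _ => (hF u).subset (hsub u)]
  refine Finset.sum_congr rfl fun u _ => ?_
  exact AddMonoidHom.map_finsum ((partHom w).comp (subst h).toAddMonoidHom) (hF u)

theorem comp_matVec (M : Matrix A A R) {V : A → Series R A} (hV : FormallySummable V)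
    {h : Series R A} (hh : PosOrder h) (a : A) :
    comp (matVec M V a) h = matVec M (fun b => comp (V b) h) a := by
  rw [matVec, comp_formalSum (hV.const_mul _) hh]
  simp only [comp_mul _ _ hh, comp_const]
  rfl

theorem comp_step {k : ℕ} (c : Series R A) (N : Fin k → Matrix A A R) {V : A → Series R A}
    (hV : FormallySummable V) {h : Series R A} (hh : PosOrder h) (a : A) :
    comp (step c N V a) h = step (comp c h) N (fun b => comp (V b) h) a := by
  rw [step, comp_mul _ _ hh, ← compHom_apply hh (List.prod _), map_list_prod, List.map_ofFn]
  simp only [Function.comp_def, compHom_apply, comp_add _ _ hh, comp_matVec _ hV hh]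
  rw [Y, comp_var]
  rfl

theorem comp_neg (f : Series R A) {h : Series R A} (hh : PosOrder h) :
    comp (-f) h = -comp f h :=
  map_neg (compHom hh) f

theorem comp_X (h : Series R A) : comp X h = h := comp_var Letter.X h

/-! ### The two inverse series. -/

/-- If `V` solves a system with initial term `c`, and `W` solves the same system with `c`
replaced by its composition with `h`, then composition with `h` takes `V` to `W`. -/
theorem comp_step_fixedPoint {k : ℕ} {c : Series R A} {N : Fin k → Matrix A A R}
    {V W : A → Series R A} (hV : step c N V = V) {h : Series R A} (hh : PosOrder h)
    (hW : step (comp c h) N W = W) : (fun a => comp (V a) h) = W := by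
  refine step_fixedPoint_unique (funext fun a => ?_) hW
  rw [← comp_step c N (formallySummable_of_step_fixedPoint hV) hh, hV]

theorem comp_total {V W : A → Series R A} (hV : FormallySummable V) (hW : PosOrder (total W))
    (h : (fun a => comp (V a) (total W)) = W) : comp (total V) (total W) = X := by
  conv_lhs => rw [total]
  rw [comp_add _ _ hW, comp_neg _ hW, comp_X, comp_formalSum hV hW, h, total]
  abel

end Series

theorem theorem1 {R : Type*} [Ring R] {A : Type*} (k : ℕ) (hk : 2 ≤ k)
    (M : Fin k → Matrix A A R) :
    (∃! V : A → Series R A, Series.IsSolution M V) ∧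
    (∃! W : A → Series R A, Series.IsDualSolution (Series.complementary M) W) ∧
    ∀ V W : A → Series R A,
      Series.IsSolution M V → Series.IsDualSolution (Series.complementary M) W →
      Series.FormallySummable V ∧ Series.FormallySummable W ∧
      Series.Composable (Series.total V) (Series.total W) ∧
      Series.Composable (Series.total W) (Series.total V) ∧
      Series.comp (Series.total V) (Series.total W) = Series.X ∧
      Series.comp (Series.total W) (Series.total V) = Series.X := by
  simp only [Series.isSolution_iff hk, Series.isDualSolution_iff hk]
  refine ⟨Series.existsUnique_step_fixedPoint _ _, Series.existsUnique_step_fixedPoint _ _, ?_⟩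
  intro V W hV hW
  have sV := Series.formallySummable_of_step_fixedPoint hV
  have sW := Series.formallySummable_of_step_fixedPoint hW
  have pV : Series.PosOrder (Series.total V) := Series.posOrder_total fun a =>
    Series.vanishing_anti _ (by omega) (Series.mem_vanishing_of_step_fixedPoint (by omega)
      Series.X_mem_vanishing hV a)
  have pW : Series.PosOrder (Series.total W) := Series.posOrder_total fun a =>
    Series.vanishing_anti _ (by omega) (Series.mem_vanishing_of_step_fixedPoint (by omega)
      (neg_mem Series.X_mem_vanishing) hW a)
  refine ⟨sV, sW, Series.composable_of_posOrder _ pW, Series.composable_of_posOrder _ pV,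
    Series.comp_total sV pW (Series.comp_step_fixedPoint hV pW ?_),
    Series.comp_total sW pV (Series.comp_step_fixedPoint hW pV ?_)⟩
  -- Factorwise, `total W - M_j W = -X + (J - M_j) W`.
  · conv_rhs => rw [← hW]
    funext a
    simp only [Series.step, Series.comp_X, Series.matVec_neg, Series.matVec_complementary M _ sW,
      Series.total, sub_eq_add_neg, add_assoc]
  -- Factorwise, `-total V + (J - M_j) V = X - M_j V`: the two copies of `formalSum V` cancel.
  · conv_rhs => rw [← hV]
    funext a
    rw [Series.comp_neg _ pV, Series.comp_X]
    simp only [Series.step, Series.matVec_neg, Series.matVec_complementary M _ sV, Series.total]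
    congr 3
    funext j
    abel
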